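/- Let $\mathcal H:=L^2(0,1)^2$ (complex-valued functions, with $\|\mathbf u\|^2=\|u_1\|_{L^2(0,1)}^2+\|u_2\|_{L^2(0,1)}^2$), let $$\mathcal D(\tilde L_0):=\{\mathbf u=(u_1,u_2)\in C^1[0,1]^2:\ u_1(0)=0\}\subset\mathcal H,$$ and define the linear operator $\tilde L_0:\mathcal D(\tilde L_0)\subset\mathcal H\to\mathcal H$ by $$(\tilde L_0\mathbf u)(\rho):=\big(-\rho u_1'(\rho)+u_2'(\rho),\ u_1'(\rho)-\rho u_2'(\rho)\big),\qquad \rho\in(0,1).$$ Then $\tilde L_0$ is closable, and its closure $L_0$ is the infinitesimal generator of a strongly continuous one-parameter semigroup $S_0:[0,\infty)\to\mathcal B(\mathcal H)$ of bounded linear operators on $\mathcal H$ satisfying $$\|S_0(\tau)\|\le e^{\frac12\tau}\qquad\text{for all }\tau\ge 0.$$ Here the infinitesimal generator of $S_0$ is the operator $A\mathbf u:=\lim_{\tau\to0+}\tau^{-1}(S_0(\tau)\mathbf u-\mathbf u)$ whose domain consists of all $\mathbf u\in\mathcal H$ for which this limit exists in $\mathcal H$. -/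

import Mathlib

open Set Filter Topology MeasureTheory
open scoped NNReal ENNReal

noncomputable section

namespace SimWave

/-! ### Strongly continuous semigroups and their generators -/

/-- A strongly continuous one-parameter semigroup `S : [0,∞) → 𝓑(E)` of bounded operators on a
complex normed space `E`. -/
structure C0Semigroup (E : Type*) [NormedAddCommGroup E] [NormedSpace ℂ E] where
  toFun : ℝ≥0 → (E →L[ℂ] E)
  map_zero : toFun 0 = ContinuousLinearMap.id ℂ E
  map_add : ∀ s t, toFun (s + t) = (toFun s).comp (toFun t)
  strongly_continuous : ∀ x, Continuous fun t => toFun t x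

/-- The graph of the generator of `S`: all pairs `(x, y)` with `(S(t)x - x) / t → y`
as `t → 0+`. -/
def C0Semigroup.generatorGraph {E : Type*} [NormedAddCommGroup E] [NormedSpace ℂ E]
    (S : C0Semigroup E) : Submodule ℂ (E × E) where
  carrier := {p | Tendsto (fun t : ℝ≥0 => ((t : ℝ) : ℂ)⁻¹ • (S.toFun t p.1 - p.1))
    (𝓝[>] 0) (𝓝 p.2)}
  zero_mem' := by simp
  add_mem' := by
    intro p q hp hq
    refine (Tendsto.add hp hq).congr fun t => ?_
    simp only [Prod.fst_add, _root_.map_add, ← smul_add]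
    congr 1
    abel
  smul_mem' := by
    intro c p hp
    refine (Tendsto.const_smul hp c).congr fun t => ?_
    simp only [Prod.smul_fst, map_smul, ← smul_sub]
    rw [smul_comm]

/-- The infinitesimal generator of `S`, as an unbounded operator: its domain is the set of all `x`
for which `lim_{t → 0+} (S(t)x - x) / t` exists, and its value at `x` is this limit
(see `C0Semigroup.mem_generator_domain` and `C0Semigroup.generator_apply`). -/
def C0Semigroup.generator {E : Type*} [NormedAddCommGroup E] [NormedSpace ℂ E]
    (S : C0Semigroup E) : E →ₗ.[ℂ] E :=
  S.generatorGraph.toLinearPMap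

theorem C0Semigroup.generator_graph {E : Type*} [NormedAddCommGroup E] [NormedSpace ℂ E]
    (S : C0Semigroup E) : S.generator.graph = S.generatorGraph := by
  refine Submodule.toLinearPMap_graph_eq _ ?_
  rintro ⟨x, y⟩ hp (hx : x = 0)
  subst hx
  refine tendsto_nhds_unique (f := fun t : ℝ≥0 => ((t : ℝ) : ℂ)⁻¹ • (S.toFun t (0 : E) - 0))
    hp ?_
  simp

theorem C0Semigroup.mem_generator_domain {E : Type*} [NormedAddCommGroup E] [NormedSpace ℂ E]
    (S : C0Semigroup E) (x : E) :
    x ∈ S.generator.domain ↔ ∃ y, Tendsto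
      (fun t : ℝ≥0 => ((t : ℝ) : ℂ)⁻¹ • (S.toFun t x - x)) (𝓝[>] 0) (𝓝 y) := by
  rw [LinearPMap.mem_domain_iff, S.generator_graph]
  rfl

theorem C0Semigroup.generator_apply {E : Type*} [NormedAddCommGroup E] [NormedSpace ℂ E]
    (S : C0Semigroup E) (x : S.generator.domain) :
    Tendsto (fun t : ℝ≥0 => ((t : ℝ) : ℂ)⁻¹ • (S.toFun t x - (x : E))) (𝓝[>] 0)
      (𝓝 (S.generator x)) := by
  have h := S.generator.mem_graph x
  rw [S.generator_graph] at h
  exact h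

/-! ### The free radial wave operator in similarity coordinates -/

/-- Lebesgue measure on the interval `(0,1)`. -/
abbrev μ01 : Measure ℝ := volume.restrict (Ioo 0 1)

/-- The Hilbert space `L²(0,1)²` of pairs of complex-valued functions, with
`‖u‖² = ‖u₁‖² + ‖u₂‖²`. -/
abbrev H : Type := WithLp 2 (Lp ℂ 2 μ01 × Lp ℂ 2 μ01)

theorem memLp_of_continuousOn {f : ℝ → ℂ} (hf : ContinuousOn f (Icc 0 1)) : MemLp f 2 μ01 := by
  obtain ⟨C, hC⟩ := isCompact_Icc.exists_bound_of_continuousOn hf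
  refine MemLp.of_bound
    ((hf.mono Ioo_subset_Icc_self).aestronglyMeasurable measurableSet_Ioo) C ?_
  exact (ae_restrict_mem measurableSet_Ioo).mono fun ρ hρ => hC ρ (Ioo_subset_Icc_self hρ)

/-- The pairs `(u₁, u₂) ∈ C¹[0,1]²` with `u₁(0) = 0`. Values outside `[0,1]` are irrelevant. -/
def C1Dom : Submodule ℂ ((ℝ → ℂ) × (ℝ → ℂ)) where
  carrier := {u | ContDiffOn ℝ 1 u.1 (Icc 0 1) ∧ ContDiffOn ℝ 1 u.2 (Icc 0 1) ∧ u.1 0 = 0}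
  zero_mem' := ⟨contDiffOn_const, contDiffOn_const, rfl⟩
  add_mem' := by
    rintro u v ⟨h1, h2, h3⟩ ⟨k1, k2, k3⟩
    exact ⟨h1.add k1, h2.add k2, by simp [h3, k3]⟩
  smul_mem' := by
    rintro c u ⟨h1, h2, h3⟩
    exact ⟨h1.const_smul c, h2.const_smul c, by simp [h3]⟩

/-- First component `-ρ u₁' + u₂'` of the differential expression. -/
def ell1 (u : (ℝ → ℂ) × (ℝ → ℂ)) (ρ : ℝ) : ℂ :=
  -(ρ : ℂ) * derivWithin u.1 (Icc 0 1) ρ + derivWithin u.2 (Icc 0 1) ρ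

/-- Second component `u₁' - ρ u₂'` of the differential expression. -/
def ell2 (u : (ℝ → ℂ) × (ℝ → ℂ)) (ρ : ℝ) : ℂ :=
  derivWithin u.1 (Icc 0 1) ρ - (ρ : ℂ) * derivWithin u.2 (Icc 0 1) ρ

theorem continuousOn_derivWithin {f : ℝ → ℂ} (hf : ContDiffOn ℝ 1 f (Icc 0 1)) :
    ContinuousOn (derivWithin f (Icc 0 1)) (Icc 0 1) :=
  hf.continuousOn_derivWithin (uniqueDiffOn_Icc zero_lt_one) le_rfl

theorem memLp_ell1 (u : C1Dom) : MemLp (ell1 u) 2 μ01 :=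
  memLp_of_continuousOn <|
    (Complex.continuous_ofReal.neg.continuousOn.mul (continuousOn_derivWithin u.2.1)).add
      (continuousOn_derivWithin u.2.2.1)

theorem memLp_ell2 (u : C1Dom) : MemLp (ell2 u) 2 μ01 :=
  memLp_of_continuousOn <|
    (continuousOn_derivWithin u.2.1).sub
      (Complex.continuous_ofReal.continuousOn.mul (continuousOn_derivWithin u.2.2.1))

theorem derivWithin_pair_add {f g : ℝ → ℂ} (hf : ContDiffOn ℝ 1 f (Icc 0 1))
    (hg : ContDiffOn ℝ 1 g (Icc 0 1)) {ρ : ℝ} (h : ρ ∈ Icc (0 : ℝ) 1) :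
    derivWithin (f + g) (Icc 0 1) ρ = derivWithin f (Icc 0 1) ρ + derivWithin g (Icc 0 1) ρ :=
  derivWithin_add (hf.differentiableOn one_ne_zero ρ h) (hg.differentiableOn one_ne_zero ρ h)

theorem derivWithin_pair_smul {f : ℝ → ℂ} (c : ℂ) (ρ : ℝ) :
    derivWithin (c • f) (Icc 0 1) ρ = c * derivWithin f (Icc 0 1) ρ :=
  derivWithin_const_smul_field c f

/-- The class in `L²(0,1)²` of a pair in `C1Dom`. -/
def toH : C1Dom →ₗ[ℂ] H where
  toFun u := WithLp.toLp 2
    ((memLp_of_continuousOn u.2.1.continuousOn).toLp u.1.1,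
      (memLp_of_continuousOn u.2.2.1.continuousOn).toLp u.1.2)
  map_add' _ _ := rfl
  map_smul' _ _ := rfl

/-- The class in `L²(0,1)²` of `(-ρ u₁' + u₂', u₁' - ρ u₂')` for a pair `u` in `C1Dom`. -/
def ellH : C1Dom →ₗ[ℂ] H where
  toFun u := WithLp.toLp 2 ((memLp_ell1 u).toLp (ell1 u), (memLp_ell2 u).toLp (ell2 u))
  map_add' u v := by
    rw [← WithLp.toLp_add, Prod.mk_add_mk, ← MemLp.toLp_add, ← MemLp.toLp_add]
    congr 2
    all_goals
      refine MemLp.toLp_congr _ _ ?_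
      refine (ae_restrict_mem measurableSet_Ioo).mono fun ρ hρ => ?_
      have h := Ioo_subset_Icc_self hρ
      have h1 := derivWithin_pair_add u.2.1 v.2.1 h
      have h2 := derivWithin_pair_add u.2.2.1 v.2.2.1 h
      simp only [ell1, ell2, Pi.add_apply, Submodule.coe_add, Prod.fst_add, Prod.snd_add, h1, h2]
      ring
  map_smul' c u := by
    rw [RingHom.id_apply, ← WithLp.toLp_smul, Prod.smul_mk, ← MemLp.toLp_const_smul,
      ← MemLp.toLp_const_smul]
    congr 2
    all_goals
      refine MemLp.toLp_congr _ _ (ae_of_all _ fun ρ => ?_)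
      simp only [ell1, ell2, Pi.smul_apply, Submodule.coe_smul, Prod.smul_fst, Prod.smul_snd,
        derivWithin_pair_smul, smul_eq_mul]
      ring

/-- The operator `L̃₀ u = (-ρ u₁' + u₂', u₁' - ρ u₂')` in `L²(0,1)²` with domain
`{u ∈ C¹[0,1]² : u₁(0) = 0}`, given through its graph
(see `L0tilde_domain` and `L0tilde_apply`). -/
def L0tilde : H →ₗ.[ℂ] H :=
  (LinearMap.range (toH.prod ellH)).toLinearPMap

theorem eqOn_zero_of_toLp_eq_zero {f : ℝ → ℂ} (hf : ContinuousOn f (Icc 0 1))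
    (h : (memLp_of_continuousOn hf).toLp f = 0) : EqOn f (fun _ => 0) (Icc 0 1) := by
  have h' : f =ᵐ[μ01] fun _ => 0 := by
    have := (memLp_of_continuousOn hf).coeFn_toLp
    rw [h] at this
    exact this.symm.trans (Lp.coeFn_zero ℂ 2 μ01)
  have h1 : EqOn f (fun _ => 0) (Ioo 0 1) :=
    Measure.eqOn_open_of_ae_eq h' isOpen_Ioo (hf.mono Ioo_subset_Icc_self) continuousOn_const
  refine h1.of_subset_closure hf continuousOn_const Ioo_subset_Icc_self ?_
  rw [closure_Ioo zero_ne_one]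

theorem derivWithin_eq_zero_of_toLp_eq_zero {f : ℝ → ℂ} (hf : ContinuousOn f (Icc 0 1))
    (h : (memLp_of_continuousOn hf).toLp f = 0) {ρ : ℝ} (hρ : ρ ∈ Icc (0 : ℝ) 1) :
    derivWithin f (Icc 0 1) ρ = 0 := by
  have h1 := eqOn_zero_of_toLp_eq_zero hf h
  rw [derivWithin_congr h1 (h1 hρ)]
  simp

theorem toLp_eq_zero_of_forall {f : ℝ → ℂ} (hf : MemLp f 2 μ01)
    (h : ∀ ρ ∈ Icc (0 : ℝ) 1, f ρ = 0) : hf.toLp f = 0 := by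
  refine (Lp.eq_zero_iff_ae_eq_zero).2 (hf.coeFn_toLp.trans ?_)
  exact (ae_restrict_mem measurableSet_Ioo).mono fun ρ hρ => h ρ (Ioo_subset_Icc_self hρ)

theorem ellH_eq_zero {u : C1Dom} (h : toH u = 0) : ellH u = 0 := by
  have hp : (toH u).ofLp = 0 := by rw [h]; rfl
  have e1 : ∀ ρ ∈ Icc (0 : ℝ) 1, derivWithin u.1.1 (Icc 0 1) ρ = 0 := fun ρ hρ =>
    derivWithin_eq_zero_of_toLp_eq_zero u.2.1.continuousOn (congrArg Prod.fst hp) hρ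
  have e2 : ∀ ρ ∈ Icc (0 : ℝ) 1, derivWithin u.1.2 (Icc 0 1) ρ = 0 := fun ρ hρ =>
    derivWithin_eq_zero_of_toLp_eq_zero u.2.2.1.continuousOn (congrArg Prod.snd hp) hρ
  have k1 : (memLp_ell1 u).toLp (ell1 u) = 0 :=
    toLp_eq_zero_of_forall _ fun ρ hρ => by simp [ell1, e1 ρ hρ, e2 ρ hρ]
  have k2 : (memLp_ell2 u).toLp (ell2 u) = 0 :=
    toLp_eq_zero_of_forall _ fun ρ hρ => by simp [ell2, e1 ρ hρ, e2 ρ hρ]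
  have k : ellH u = WithLp.toLp 2 ((memLp_ell1 u).toLp (ell1 u), (memLp_ell2 u).toLp (ell2 u)) :=
    rfl
  rw [k, k1, k2]
  rfl

theorem L0tilde_graph : L0tilde.graph = LinearMap.range (toH.prod ellH) := by
  refine Submodule.toLinearPMap_graph_eq _ ?_
  rintro _ ⟨u, rfl⟩ hx
  exact ellH_eq_zero hx

theorem L0tilde_domain : L0tilde.domain = LinearMap.range toH := by
  ext x
  rw [LinearPMap.mem_domain_iff, L0tilde_graph]
  constructor
  · rintro ⟨y, u, hu⟩
    exact ⟨u, congrArg Prod.fst hu⟩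
  · rintro ⟨u, rfl⟩
    exact ⟨ellH u, u, rfl⟩

theorem toH_mem_domain (u : C1Dom) : toH u ∈ L0tilde.domain := by
  rw [L0tilde_domain]
  exact ⟨u, rfl⟩

theorem L0tilde_apply (u : C1Dom) : L0tilde ⟨toH u, toH_mem_domain u⟩ = ellH u := by
  have h : (toH u, ellH u) ∈ L0tilde.graph := by
    rw [L0tilde_graph]
    exact ⟨u, rfl⟩
  obtain ⟨y, hy, hy'⟩ := (LinearPMap.mem_graph_iff _).1 h
  rw [← show L0tilde y = ellH u from hy']
  exact congrArg L0tilde (Subtype.ext hy.symm)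

end SimWave

end

/-!
The substitution `w(y) = u₂(|y|) + sign(y) u₁(|y|)` on `(-1,1)`, continuous at `0` because
`u₁(0) = 0`, turns the operator into `(1 - y) d/dy`. The powers `(1 - y)ⁿ` are therefore
eigenvectors with eigenvalues `-n`; in the original variables they are the pairs of the odd and
the even part of `(1 - ρ)ⁿ` (`ellH_eigenPair`). They span a dense subspace of `L²(0,1)²`
(`denseRange_eigenPair`), by the Weierstrass theorem in the variable `ρ²`. Integration by parts
gives `Re ⟪u, L u⟫ = ‖u‖² / 2 - |u₁(1) - u₂(1)|² / 2 ≤ ‖u‖² / 2` (`re_inner_ellH`), so that the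
operator is quasi-dissipative with bound `1/2`.

The rest holds on any complex Hilbert space (`exists_semigroup_generator_eq_closure`): an operator
`A` with `Re ⟪x, A x⟫ ≤ ω ‖x‖²` and a densely spanning family of eigenvectors `eᵢ`, with
eigenvalues `lᵢ`, is closable and its closure generates a semigroup bounded by `exp (ω t)`. On
finite combinations of eigenvectors the semigroup is `∑ cᵢ eᵢ ↦ ∑ cᵢ exp (t lᵢ) eᵢ`; the bound
`exp (ω t)` is the energy estimate `norm_eigenFlow_le`, and it allows the extension by density. The
bound from below for `ω + 1 - A` shows that every quasi-dissipative extension of `A` restricted to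
the finite combinations lies in the closure `C` of that restriction
(`QuasiDissipative.le_closure_eigenGraph`). This applies to `A` itself and to the generator, while
`C` is contained in the closure of `A` and in the generator
(`closure_eigenGraph_le_generatorGraph`); hence the generator is the closure of `A`.
-/

namespace SimWave

/-! ### Quasi-dissipative graphs -/

section Abstract

open scoped InnerProductSpace

variable {E : Type*} [NormedAddCommGroup E] [InnerProductSpace ℂ E] {ι : Type*}

/-- The graph `Γ` of a (possibly multivalued) linear operator `A` is quasi-dissipative with
bound `ω` if `Re ⟪x, A x⟫ ≤ ω ‖x‖²` on the domain of `A`. -/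
def QuasiDissipative (ω : ℝ) (Γ : Submodule ℂ (E × E)) : Prop :=
  ∀ p ∈ Γ, (⟪p.1, p.2⟫_ℂ).re ≤ ω * ‖p.1‖ ^ 2

/-- `ω + 1 - A` is bounded below by `1` when `A` is quasi-dissipative with bound `ω`. -/
theorem QuasiDissipative.norm_le {ω : ℝ} {Γ : Submodule ℂ (E × E)} (h : QuasiDissipative ω Γ)
    {p : E × E} (hp : p ∈ Γ) : ‖p.1‖ ≤ ‖((ω + 1 : ℝ) : ℂ) • p.1 - p.2‖ := by
  have h1 := h p hp
  have h2 : (⟪p.1, ((ω + 1 : ℝ) : ℂ) • p.1 - p.2⟫_ℂ).re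
      = (ω + 1) * ‖p.1‖ ^ 2 - (⟪p.1, p.2⟫_ℂ).re := by
    rw [inner_sub_right, inner_smul_right, inner_self_eq_norm_sq_to_K, Complex.sub_re,
      Complex.re_ofReal_mul]
    norm_cast
  have h3 : (⟪p.1, ((ω + 1 : ℝ) : ℂ) • p.1 - p.2⟫_ℂ).re
      ≤ ‖p.1‖ * ‖((ω + 1 : ℝ) : ℂ) • p.1 - p.2‖ :=
    (Complex.re_le_norm _).trans (norm_inner_le_norm _ _)
  rcases (norm_nonneg p.1).eq_or_lt with h0 | h0
  · rw [← h0]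
    exact norm_nonneg _
  · refine le_of_mul_le_mul_left ?_ h0
    nlinarith

/-! ### The flow of a diagonal operator -/

/-- The flow at time `t` of the operator with eigenvectors `e i` and eigenvalues `l i`, on finite
linear combinations of the `e i`: it takes `∑ cᵢ eᵢ`, represented by its coefficients `c`, to
`∑ cᵢ exp (t lᵢ) eᵢ`. -/
noncomputable def eigenFlow (e : ι → E) (l : ι → ℂ) (t : ℝ) : (ι →₀ ℂ) →ₗ[ℂ] E :=
  Finsupp.linearCombination ℂ fun i => Complex.exp (t * l i) • e i

/-- Multiplication of the `i`-th coefficient by `l i`. -/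
noncomputable def diagMul (l : ι → ℂ) : (ι →₀ ℂ) →ₗ[ℂ] (ι →₀ ℂ) :=
  Finsupp.linearCombination ℂ fun i => Finsupp.single i (l i)

theorem eigenFlow_single (e : ι → E) (l : ι → ℂ) (t : ℝ) (i : ι) (a : ℂ) :
    eigenFlow e l t (Finsupp.single i a) = a • Complex.exp (t * l i) • e i := by
  simp [eigenFlow]

theorem diagMul_single (l : ι → ℂ) (i : ι) (a : ℂ) :
    diagMul l (Finsupp.single i a) = Finsupp.single i (a * l i) := by
  simp [diagMul]

theorem eigenFlow_zero (e : ι → E) (l : ι → ℂ) :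
    eigenFlow e l 0 = Finsupp.linearCombination ℂ e := by
  simp [eigenFlow]

theorem hasDerivAt_eigenFlow (e : ι → E) (l : ι → ℂ) (c : ι →₀ ℂ) (t : ℝ) :
    HasDerivAt (fun s : ℝ => eigenFlow e l s c) (eigenFlow e l t (diagMul l c)) t := by
  induction c using Finsupp.induction_linear with
  | zero => simpa using hasDerivAt_const t (0 : E)
  | add c d hc hd => simpa only [map_add] using hc.fun_add hd
  | single i a =>
    simp only [eigenFlow_single, diagMul_single]
    have h : HasDerivAt (fun s : ℝ => Complex.exp (s * l i)) (Complex.exp (t * l i) * l i) t := by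
      simpa using ((Complex.ofRealCLM.hasDerivAt (x := t)).mul_const (l i)).cexp
    have h' := ((h.smul_const (e i)).const_smul a)
    rw [mul_comm (Complex.exp (t * l i)), mul_smul, smul_smul] at h'
    exact h'

theorem eigenFlow_mem {e : ι → E} {l : ι → ℂ} {Γ : Submodule ℂ (E × E)}
    (he : ∀ i, (e i, l i • e i) ∈ Γ) (t : ℝ) (c : ι →₀ ℂ) :
    (eigenFlow e l t c, eigenFlow e l t (diagMul l c)) ∈ Γ := by
  induction c using Finsupp.induction_linear with
  | zero =>
    simp only [map_zero]
    exact Γ.zero_mem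
  | add c d hc hd =>
    simp only [map_add]
    exact Γ.add_mem hc hd
  | single i a =>
    convert Γ.smul_mem (a * Complex.exp (t * l i)) (he i) using 1
    simp only [eigenFlow_single, diagMul_single, Prod.smul_mk, smul_smul]
    congr 2
    ring

/-- The energy estimate: `exp (-2ωt) ‖u(t)‖²` is nonincreasing along the flow. -/
theorem norm_eigenFlow_le {ω : ℝ} {e : ι → E} {l : ι → ℂ} {Γ : Submodule ℂ (E × E)}
    (hΓ : QuasiDissipative ω Γ) (he : ∀ i, (e i, l i • e i) ∈ Γ) {t : ℝ} (ht : 0 ≤ t)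
    (c : ι →₀ ℂ) :
    ‖eigenFlow e l t c‖ ≤ Real.exp (ω * t) * ‖Finsupp.linearCombination ℂ e c‖ := by
  let u : ℝ → E := fun s => eigenFlow e l s c
  let u' : ℝ → E := fun s => eigenFlow e l s (diagMul l c)
  let _ : InnerProductSpace ℝ E := InnerProductSpace.rclikeToReal ℂ E
  have hu : ∀ s, HasDerivAt u (u' s) s := hasDerivAt_eigenFlow e l c
  have hN : ∀ s, HasDerivAt (fun s => ‖u s‖ ^ 2) (2 * (⟪u s, u' s⟫_ℂ).re) s := fun s => by
    have := (hu s).norm_sq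
    exact this
  have hg : ∀ s, HasDerivAt (fun s => Real.exp (-2 * ω * s) * ‖u s‖ ^ 2)
      (Real.exp (-2 * ω * s) * (-2 * ω) * ‖u s‖ ^ 2
        + Real.exp (-2 * ω * s) * (2 * (⟪u s, u' s⟫_ℂ).re)) s := fun s => by
    have h1 : HasDerivAt (fun s => Real.exp (-2 * ω * s)) (Real.exp (-2 * ω * s) * (-2 * ω)) s := by
      simpa using ((hasDerivAt_id s).const_mul (-2 * ω)).exp
    exact h1.mul (hN s)
  have hanti : Antitone fun s => Real.exp (-2 * ω * s) * ‖u s‖ ^ 2 := by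
    refine antitone_of_deriv_nonpos (fun s => (hg s).differentiableAt) fun s => ?_
    rw [(hg s).deriv]
    have h1 := hΓ _ (eigenFlow_mem he s c)
    have h2 := Real.exp_pos (-2 * ω * s)
    change (⟪u s, u' s⟫_ℂ).re ≤ ω * ‖u s‖ ^ 2 at h1
    nlinarith
  have h := hanti ht
  simp only [mul_zero, Real.exp_zero, one_mul] at h
  have h0 : u 0 = Finsupp.linearCombination ℂ e c := by
    simp only [u, eigenFlow_zero]
  rw [h0] at h
  refine le_of_sq_le_sq ?_ (by positivity)
  have h3 : Real.exp (ω * t) ^ 2 * Real.exp (-2 * ω * t) = 1 := by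
    rw [← Real.exp_nat_mul, ← Real.exp_add]
    simp only [Nat.cast_ofNat, Real.exp_eq_one_iff]
    ring
  calc ‖u t‖ ^ 2 = Real.exp (ω * t) ^ 2 * (Real.exp (-2 * ω * t) * ‖u t‖ ^ 2) := by
        rw [← mul_assoc, h3, one_mul]
    _ ≤ Real.exp (ω * t) ^ 2 * ‖Finsupp.linearCombination ℂ e c‖ ^ 2 := by gcongr
    _ = _ := by ring

/-- The graph of the diagonal operator on finite linear combinations of the `e i`. -/
noncomputable def eigenGraph (e : ι → E) (l : ι → ℂ) : Submodule ℂ (E × E) :=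
  LinearMap.range ((Finsupp.linearCombination ℂ e).prod
    ((Finsupp.linearCombination ℂ e).comp (diagMul l)))

theorem eigenGraph_le {e : ι → E} {l : ι → ℂ} {Γ : Submodule ℂ (E × E)}
    (he : ∀ i, (e i, l i • e i) ∈ Γ) : eigenGraph e l ≤ Γ := by
  rintro _ ⟨c, rfl⟩
  simpa [eigenFlow_zero] using eigenFlow_mem he 0 c

/-- A quasi-dissipative extension of a diagonal operator with densely spanning eigenvectors is
contained in its closure: since `ω + 1 - A` is bounded below on the extension and maps finite
combinations of eigenvectors onto a dense subspace, approximating `(ω + 1 - A) x` approximates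
`x` and `A x`. -/
theorem QuasiDissipative.le_closure_eigenGraph {ω : ℝ} {e : ι → E} {l : ι → ℂ}
    {Γ : Submodule ℂ (E × E)} (hΓ : QuasiDissipative ω Γ) (he : ∀ i, (e i, l i • e i) ∈ Γ)
    (hd : DenseRange (Finsupp.linearCombination ℂ e)) :
    Γ ≤ (eigenGraph e l).topologicalClosure := by
  set z : ℂ := ((ω + 1 : ℝ) : ℂ) with hz
  let Φ := Finsupp.linearCombination ℂ e
  let R : (ι →₀ ℂ) →ₗ[ℂ] E := z • Φ - Φ.comp (diagMul l)
  have hR : DenseRange R := by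
    have hle : LinearMap.range Φ ≤ LinearMap.range R := by
      rw [Finsupp.range_linearCombination, Submodule.span_le]
      rintro _ ⟨i, rfl⟩
      by_cases hi : z = l i
      · -- an index whose eigenvalue is `ω + 1` carries the zero vector
        have h0 := hΓ.norm_le (he i)
        simp only [← hz, hi, sub_self, norm_zero, norm_le_zero_iff] at h0
        rw [h0]
        exact Submodule.zero_mem _
      · refine ⟨Finsupp.single i (z - l i)⁻¹, ?_⟩
        simp only [R, Φ, LinearMap.sub_apply, LinearMap.smul_apply, LinearMap.comp_apply,
          diagMul_single, Finsupp.linearCombination_single, smul_smul, ← sub_smul]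
        rw [mul_comm z, ← mul_sub, inv_mul_cancel₀ (sub_ne_zero.2 hi), one_smul]
    exact Dense.mono (fun x hx => hle hx) hd
  rintro ⟨x, y⟩ hp
  rw [← SetLike.mem_coe, Submodule.topologicalClosure_coe, Metric.mem_closure_iff]
  intro ε hε
  set K := ‖z‖ + 1
  have hK : 0 < K := by positivity
  obtain ⟨c, hc⟩ := hR.exists_dist_lt (z • x - y) (div_pos hε hK)
  refine ⟨(Φ c, Φ (diagMul l c)), ⟨c, rfl⟩, ?_⟩
  have hm : (x - Φ c, y - Φ (diagMul l c)) ∈ Γ := Γ.sub_mem hp (eigenGraph_le he ⟨c, rfl⟩)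
  have hn := hΓ.norm_le hm
  have hc' : ‖z • (x - Φ c) - (y - Φ (diagMul l c))‖ < ε / K := by
    have hsub : z • (x - Φ c) - (y - Φ (diagMul l c)) = z • x - y - R c := by
      simp only [R, LinearMap.sub_apply, LinearMap.smul_apply, LinearMap.comp_apply, smul_sub]
      abel
    rwa [hsub, ← dist_eq_norm]
  have h1 : ‖x - Φ c‖ < ε / K := hn.trans_lt hc'
  have h2 : ‖y - Φ (diagMul l c)‖ < ε := by
    calc ‖y - Φ (diagMul l c)‖
        = ‖z • (x - Φ c) - (z • (x - Φ c) - (y - Φ (diagMul l c)))‖ := by rw [sub_sub_cancel]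
      _ ≤ ‖z • (x - Φ c)‖ + ‖z • (x - Φ c) - (y - Φ (diagMul l c))‖ := norm_sub_le _ _
      _ = ‖z‖ * ‖x - Φ c‖ + ‖z • (x - Φ c) - (y - Φ (diagMul l c))‖ := by rw [norm_smul]
      _ < ‖z‖ * (ε / K) + ε / K := by
        refine add_lt_add_of_le_of_lt ?_ hc'
        gcongr
      _ = ε := by
        field_simp
        rfl
  rw [dist_eq_norm, Prod.mk_sub_mk, Prod.norm_mk, max_lt_iff]
  refine ⟨h1.trans_le (div_le_self hε.le ?_), h2⟩
  simp [K]

/-! ### Generation of the semigroup -/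

theorem tendsto_coe_nhdsGT_zero :
    Tendsto (fun t : ℝ≥0 => (t : ℝ)) (𝓝[>] 0) (𝓝[>] 0) := by
  refine tendsto_nhdsWithin_iff.2 ⟨?_, ?_⟩
  · exact (NNReal.continuous_coe.tendsto' 0 0 rfl).mono_left nhdsWithin_le_nhds
  · filter_upwards [self_mem_nhdsWithin] with t ht
    exact NNReal.coe_pos.2 ht

/-- The generator of a semigroup with `‖S(t)‖ ≤ exp (ω t)` is quasi-dissipative: this is the
derivative at `t = 0` of `Re ⟪x, S(t) x⟫ ≤ exp (ω t) ‖x‖²`. -/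
theorem C0Semigroup.quasiDissipative_generatorGraph (S : C0Semigroup E)
    {ω : ℝ} (hS : ∀ t : ℝ≥0, ‖S.toFun t‖ ≤ Real.exp (ω * t)) : QuasiDissipative ω S.generatorGraph := by
  rintro ⟨x, y⟩
    (hp : Tendsto (fun t : ℝ≥0 => ((t : ℝ) : ℂ)⁻¹ • (S.toFun t x - x)) (𝓝[>] 0) (𝓝 y))
  have hexp : HasDerivAt (fun t : ℝ => Real.exp (ω * t)) ω 0 := by
    simpa using ((hasDerivAt_id (0 : ℝ)).const_mul ω).exp
  have h1 : Tendsto (fun t : ℝ≥0 => (t : ℝ)⁻¹ * (Real.exp (ω * t) - 1) * ‖x‖ ^ 2) (𝓝[>] 0)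
      (𝓝 (ω * ‖x‖ ^ 2)) := by
    have h := (hexp.tendsto_slope_zero_right.comp tendsto_coe_nhdsGT_zero).mul_const (‖x‖ ^ 2)
    simpa [Function.comp_def] using h
  have h2 : Tendsto (fun t : ℝ≥0 => (⟪x, ((t : ℝ) : ℂ)⁻¹ • (S.toFun t x - x)⟫_ℂ).re) (𝓝[>] 0)
      (𝓝 (⟪x, y⟫_ℂ).re) :=
    (Complex.continuous_re.tendsto _).comp (tendsto_const_nhds.inner hp)
  refine le_of_tendsto_of_tendsto h2 h1 (Eventually.of_forall fun t => ?_)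
  have h3 : (⟪x, S.toFun t x⟫_ℂ).re ≤ Real.exp (ω * t) * ‖x‖ ^ 2 := by
    calc (⟪x, S.toFun t x⟫_ℂ).re ≤ ‖x‖ * ‖S.toFun t x‖ :=
          (Complex.re_le_norm _).trans (norm_inner_le_norm _ _)
      _ ≤ ‖x‖ * (Real.exp (ω * t) * ‖x‖) := by
        gcongr
        exact ContinuousLinearMap.le_of_opNorm_le _ (hS t) x
      _ = _ := by ring
  have h4 : (⟪x, x⟫_ℂ).re = ‖x‖ ^ 2 := by
    rw [inner_self_eq_norm_sq_to_K]
    norm_cast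
  dsimp only
  rw [inner_smul_right, inner_sub_right, ← Complex.ofReal_inv, Complex.re_ofReal_mul,
    Complex.sub_re, h4, mul_assoc]
  gcongr
  linarith

variable [CompleteSpace E]

/-- The extension of `eigenFlow e l t` to a bounded operator on the whole space. -/
noncomputable def eigenOp (e : ι → E) (l : ι → ℂ) (t : ℝ) : E →L[ℂ] E :=
  (eigenFlow e l t).extendOfNorm (Finsupp.linearCombination ℂ e)

theorem eigenOp_apply {ω : ℝ} {e : ι → E} {l : ι → ℂ} {Γ : Submodule ℂ (E × E)}
    (hΓ : QuasiDissipative ω Γ) (he : ∀ i, (e i, l i • e i) ∈ Γ)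
    (hd : DenseRange (Finsupp.linearCombination ℂ e)) {t : ℝ} (ht : 0 ≤ t) (c : ι →₀ ℂ) :
    eigenOp e l t (Finsupp.linearCombination ℂ e c) = eigenFlow e l t c :=
  LinearMap.extendOfNorm_eq hd ⟨_, norm_eigenFlow_le hΓ he ht⟩ c

theorem norm_eigenOp_le {ω : ℝ} {e : ι → E} {l : ι → ℂ} {Γ : Submodule ℂ (E × E)}
    (hΓ : QuasiDissipative ω Γ) (he : ∀ i, (e i, l i • e i) ∈ Γ)
    (hd : DenseRange (Finsupp.linearCombination ℂ e)) {t : ℝ} (ht : 0 ≤ t) :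
    ‖eigenOp e l t‖ ≤ Real.exp (ω * t) :=
  LinearMap.opNorm_extendOfNorm_le hd (Real.exp_pos _).le (norm_eigenFlow_le hΓ he ht)

theorem norm_eigenOp_apply_le {ω : ℝ} {e : ι → E} {l : ι → ℂ} {Γ : Submodule ℂ (E × E)}
    (hΓ : QuasiDissipative ω Γ) (he : ∀ i, (e i, l i • e i) ∈ Γ)
    (hd : DenseRange (Finsupp.linearCombination ℂ e)) {t T : ℝ} (ht : 0 ≤ t) (hT : t ≤ T)
    (x : E) : ‖eigenOp e l t x‖ ≤ Real.exp (|ω| * T) * ‖x‖ := by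
  refine (ContinuousLinearMap.le_opNorm _ _).trans ?_
  gcongr
  refine (norm_eigenOp_le hΓ he hd ht).trans (Real.exp_le_exp.2 ?_)
  exact mul_le_mul (le_abs_self ω) hT ht (abs_nonneg ω)

theorem continuous_eigenOp_apply {ω : ℝ} {e : ι → E} {l : ι → ℂ} {Γ : Submodule ℂ (E × E)}
    (hΓ : QuasiDissipative ω Γ) (he : ∀ i, (e i, l i • e i) ∈ Γ)
    (hd : DenseRange (Finsupp.linearCombination ℂ e)) (x : E) :
    Continuous fun t : ℝ≥0 => eigenOp e l t x := by
  refine continuous_of_locally_uniform_approx_of_continuousAt fun t₀ U hU => ?_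
  obtain ⟨ε, hε, hεU⟩ := Metric.mem_uniformity_dist.1 hU
  -- the operators are bounded by `M` on the neighbourhood `t < t₀ + 1` of `t₀`
  set M := Real.exp (|ω| * (t₀ + 1))
  have hM : 0 < M := Real.exp_pos _
  obtain ⟨c, hc⟩ := hd.exists_dist_lt x (div_pos hε hM)
  refine ⟨Iio (t₀ + 1), Iio_mem_nhds (by simp),
    fun t => eigenOp e l t (Finsupp.linearCombination ℂ e c), ?_, fun t ht => hεU ?_⟩
  · simp only [eigenOp_apply hΓ he hd (NNReal.coe_nonneg _)]
    exact (hasDerivAt_eigenFlow e l c t₀).continuousAt.comp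
      (f := fun t : ℝ≥0 => (t : ℝ)) NNReal.continuous_coe.continuousAt
  · rw [dist_eq_norm, ← map_sub]
    have ht' : (t : ℝ) ≤ t₀ + 1 := by exact_mod_cast (le_of_lt (mem_Iio.1 ht))
    refine (norm_eigenOp_apply_le hΓ he hd t.2 ht' _).trans_lt ?_
    rw [dist_eq_norm, lt_div_iff₀ hM] at hc
    rwa [mul_comm]

/-- The semigroup with `S(t) eᵢ = exp (t lᵢ) eᵢ`. -/
noncomputable def eigenSemigroup {ω : ℝ} {e : ι → E} {l : ι → ℂ} {Γ : Submodule ℂ (E × E)}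
    (hΓ : QuasiDissipative ω Γ) (he : ∀ i, (e i, l i • e i) ∈ Γ)
    (hd : DenseRange (Finsupp.linearCombination ℂ e)) : C0Semigroup E where
  toFun t := eigenOp e l t
  map_zero := by
    refine ContinuousLinearMap.ext fun x => ?_
    refine congrFun (hd.equalizer (eigenOp e l _).continuous
      (ContinuousLinearMap.id ℂ E).continuous (funext fun c => ?_)) x
    simp [eigenOp_apply hΓ he hd le_rfl, eigenFlow_zero]
  map_add s t := by
    refine ContinuousLinearMap.ext fun x => ?_
    refine congrFun (hd.equalizer (eigenOp e l _).continuous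
      ((eigenOp e l s).comp (eigenOp e l t)).continuous (funext fun c => ?_)) x
    have hsingle : ∀ (r : ℝ≥0) (i : ι),
        eigenOp e l r (e i) = Complex.exp ((r : ℝ) * l i) • e i := fun r i => by
      simpa [eigenFlow_single] using eigenOp_apply hΓ he hd r.2 (Finsupp.single i 1)
    induction c using Finsupp.induction_linear with
    | zero => simp
    | add c d hc hd => simpa using congrArg₂ (· + ·) hc hd
    | single i a =>
      simp only [Function.comp_apply, Finsupp.linearCombination_single, map_smul,
        ContinuousLinearMap.comp_apply, hsingle, smul_smul, ← Complex.exp_add]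
      congr 3
      push_cast
      ring
  strongly_continuous := continuous_eigenOp_apply hΓ he hd

/-- The mean value inequality along the flow, which passes to limits in the graph norm. -/
theorem norm_eigenOp_sub_le {ω : ℝ} {e : ι → E} {l : ι → ℂ} {Γ : Submodule ℂ (E × E)}
    (hΓ : QuasiDissipative ω Γ) (he : ∀ i, (e i, l i • e i) ∈ Γ)
    (hd : DenseRange (Finsupp.linearCombination ℂ e)) {p : E × E}
    (hp : p ∈ (eigenGraph e l).topologicalClosure) {t : ℝ} (ht : 0 ≤ t) :
    ‖eigenOp e l t p.1 - p.1‖ ≤ Real.exp (|ω| * t) * ‖p.2‖ * t := by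
  rw [← SetLike.mem_coe, Submodule.topologicalClosure_coe] at hp
  refine closure_minimal (t := {p : E × E | ‖eigenOp e l t p.1 - p.1‖
    ≤ Real.exp (|ω| * t) * ‖p.2‖ * t}) ?_ (isClosed_le (by fun_prop) (by fun_prop)) hp
  rintro _ ⟨c, rfl⟩
  have hb : ∀ s ∈ Ico 0 t, ‖eigenFlow e l s (diagMul l c)‖
      ≤ Real.exp (|ω| * t) * ‖Finsupp.linearCombination ℂ e (diagMul l c)‖ := fun s hs => by
    rw [← eigenOp_apply hΓ he hd hs.1]
    exact norm_eigenOp_apply_le hΓ he hd hs.1 hs.2.le _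
  have h := norm_image_sub_le_of_norm_deriv_le_segment'
    (fun s _ => (hasDerivAt_eigenFlow e l c s).hasDerivWithinAt) hb t (right_mem_Icc.2 ht)
  simpa [eigenOp_apply hΓ he hd ht, eigenFlow_zero] using h

/-- Difference quotients at small times are bounded, in the graph norm, on the closure of the
diagonal operator, and they converge on finite combinations of eigenvectors; hence they converge
on the closure. -/
theorem closure_eigenGraph_le_generatorGraph {ω : ℝ} {e : ι → E} {l : ι → ℂ}
    {Γ : Submodule ℂ (E × E)} (hΓ : QuasiDissipative ω Γ) (he : ∀ i, (e i, l i • e i) ∈ Γ)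
    (hd : DenseRange (Finsupp.linearCombination ℂ e)) :
    (eigenGraph e l).topologicalClosure ≤ (eigenSemigroup hΓ he hd).generatorGraph := by
  rintro ⟨x, y⟩ hp
  change Tendsto (fun t : ℝ≥0 => ((t : ℝ) : ℂ)⁻¹ • (eigenOp e l t x - x)) (𝓝[>] 0) (𝓝 y)
  rw [Metric.tendsto_nhds]
  intro ε hε
  set M := Real.exp |ω|
  have hM : 0 < M := Real.exp_pos _
  set δ := ε / (M + 2) with hδ
  have hδ0 : 0 < δ := by positivity
  have hp' := hp
  rw [← SetLike.mem_coe, Submodule.topologicalClosure_coe, Metric.mem_closure_iff] at hp'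
  obtain ⟨_, ⟨c, rfl⟩, hc⟩ := hp' δ hδ0
  set p := Finsupp.linearCombination ℂ e c with hpdef
  set q := Finsupp.linearCombination ℂ e (diagMul l c)
  change dist (x, y) (p, q) < δ at hc
  have hyq : ‖y - q‖ < δ := by
    rw [dist_eq_norm, Prod.mk_sub_mk, Prod.norm_mk, max_lt_iff] at hc
    exact hc.2
  have hdiff : (x - p, y - q) ∈ (eigenGraph e l).topologicalClosure :=
    Submodule.sub_mem _ hp (Submodule.le_topologicalClosure _ ⟨c, rfl⟩)
  have hlim : Tendsto (fun t : ℝ≥0 => ((t : ℝ) : ℂ)⁻¹ • (eigenOp e l t p - p)) (𝓝[>] 0) (𝓝 q) := by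
    have h := (hasDerivAt_eigenFlow e l c 0).tendsto_slope_zero_right
    have h2 := h.comp tendsto_coe_nhdsGT_zero
    simp only [eigenFlow_zero] at h2
    refine h2.congr fun t => ?_
    simp only [Function.comp_apply, zero_add]
    rw [hpdef, eigenOp_apply hΓ he hd t.coe_nonneg, ← Complex.ofReal_inv, Complex.coe_smul]
  have h1 : Iio (1 : ℝ≥0) ∈ 𝓝[>] (0 : ℝ≥0) := nhdsWithin_le_nhds (Iio_mem_nhds zero_lt_one)
  filter_upwards [Metric.tendsto_nhds.1 hlim δ hδ0, h1, self_mem_nhdsWithin] with t ht ht1 ht0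
  have ht0' : (0 : ℝ) < t := NNReal.coe_pos.2 ht0
  have ht1' : (t : ℝ) ≤ 1 := by exact_mod_cast le_of_lt (mem_Iio.1 ht1)
  have hA : ‖((t : ℝ) : ℂ)⁻¹ • (eigenOp e l t (x - p) - (x - p))‖ ≤ M * δ := by
    have h := norm_eigenOp_sub_le hΓ he hd hdiff ht0'.le
    rw [norm_smul, norm_inv, Complex.norm_real, Real.norm_of_nonneg ht0'.le,
      inv_mul_le_iff₀ ht0', mul_comm]
    refine h.trans ?_
    have hexp : Real.exp (|ω| * t) ≤ M :=
      Real.exp_le_exp.2 (mul_le_of_le_one_right (abs_nonneg ω) ht1')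
    gcongr
  rw [dist_eq_norm] at ht ⊢
  have hsplit : ((t : ℝ) : ℂ)⁻¹ • (eigenOp e l t x - x) - y
      = ((t : ℝ) : ℂ)⁻¹ • (eigenOp e l t (x - p) - (x - p))
        + (((t : ℝ) : ℂ)⁻¹ • (eigenOp e l t p - p) - q) - (y - q) := by
    simp only [map_sub, smul_sub]
    abel
  rw [hsplit]
  calc _ ≤ _ + ‖y - q‖ := norm_sub_le _ _
    _ ≤ _ + _ + ‖y - q‖ := by gcongr; exact norm_add_le _ _
    _ < M * δ + δ + δ := by linarith
    _ = ε := by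
      rw [hδ]
      field_simp
      ring

/-- A quasi-dissipative operator on a Hilbert space whose eigenvectors span a dense subspace is
closable, and its closure generates a semigroup with `‖S(t)‖ ≤ exp (ω t)`. -/
theorem exists_semigroup_generator_eq_closure {ω : ℝ} {A : E →ₗ.[ℂ] E}
    (hA : QuasiDissipative ω A.graph) {e : ι → E} {l : ι → ℂ}
    (he : ∀ i, (e i, l i • e i) ∈ A.graph) (hd : DenseRange (Finsupp.linearCombination ℂ e)) :
    A.IsClosable ∧ ∃ S : C0Semigroup E, S.generator = A.closure ∧
      ∀ t : ℝ≥0, ‖S.toFun t‖ ≤ Real.exp (ω * t) := by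
  let S := eigenSemigroup hA he hd
  have hS : ∀ t : ℝ≥0, ‖S.toFun t‖ ≤ Real.exp (ω * t) := fun t => norm_eigenOp_le hA he hd t.2
  have hle := closure_eigenGraph_le_generatorGraph hA he hd
  have hgen : S.generatorGraph = (eigenGraph e l).topologicalClosure := by
    refine le_antisymm ?_ hle
    refine (S.quasiDissipative_generatorGraph hS).le_closure_eigenGraph (fun i => hle ?_) hd
    refine Submodule.le_topologicalClosure _ ⟨Finsupp.single i 1, ?_⟩
    simp [diagMul_single]
  have hclos : A.graph.topologicalClosure = (eigenGraph e l).topologicalClosure := by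
    refine le_antisymm ?_ (Submodule.topologicalClosure_mono (eigenGraph_le he))
    exact Submodule.topologicalClosure_minimal _ (hA.le_closure_eigenGraph he hd)
      (Submodule.isClosed_topologicalClosure _)
  have hgraph : A.graph.topologicalClosure = S.generator.graph := by
    rw [hclos, ← hgen, S.generator_graph]
  have hcl : A.IsClosable := ⟨S.generator, hgraph⟩
  exact ⟨hcl, S, LinearPMap.eq_of_eq_graph (hgraph.symm.trans hcl.graph_closure_eq_closure_graph),
    hS⟩

end Abstract

/-! ### Density of even polynomials on the unit interval -/

open scoped InnerProductSpace

theorem integrable_continuousOn_smul {f : ℝ → ℂ} (hf : Integrable f μ01) {φ : ℝ → ℝ}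
    (hφ : ContinuousOn φ (Icc 0 1)) : Integrable (fun ρ => φ ρ • f ρ) μ01 := by
  have h : IntegrableOn f (Icc 0 1) := by
    rwa [integrableOn_Icc_iff_integrableOn_Ioo]
  exact (h.continuousOn_smul hφ isCompact_Icc).mono_set Ioo_subset_Icc_self

/-- An integrable function on `(0,1)` whose even moments all vanish is zero: every continuous
function of `ρ ∈ [0,1]` is a continuous function of `ρ²`, hence a uniform limit of polynomials
in `ρ²`. -/
theorem ae_eq_zero_of_even_moments {f : ℝ → ℂ} (hf : Integrable f μ01)
    (h : ∀ k : ℕ, ∫ ρ, ρ ^ (2 * k) • f ρ ∂μ01 = 0) : f =ᵐ[μ01] 0 := by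
  have hpoly : ∀ q : Polynomial ℝ, ∫ ρ, q.eval (ρ ^ 2) • f ρ ∂μ01 = 0 := fun q => by
    induction q using Polynomial.induction_on' with
    | add p q hp hq =>
      simp only [Polynomial.eval_add, add_smul]
      rw [integral_add, hp, hq, add_zero]
      · exact integrable_continuousOn_smul hf (by fun_prop)
      · exact integrable_continuousOn_smul hf (by fun_prop)
    | monomial k a =>
      simp only [Polynomial.eval_monomial, ← pow_mul, mul_smul]
      rw [integral_smul, h, smul_zero]
  have hcont : ∀ φ : ℝ → ℝ, Continuous φ → ∫ ρ, φ ρ • f ρ ∂μ01 = 0 := fun φ hφ => by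
    rw [← norm_le_zero_iff]
    refine le_of_forall_pos_le_add fun ε hε => ?_
    set I := ∫ ρ, ‖f ρ‖ ∂μ01
    have hI : 0 ≤ I := integral_nonneg fun _ => norm_nonneg _
    obtain ⟨q, hq⟩ := exists_polynomial_near_of_continuousOn 0 1 (fun t => φ (√t))
      (by fun_prop) (ε / (I + 1)) (by positivity)
    have hsub : ∫ ρ, φ ρ • f ρ ∂μ01 = ∫ ρ, (φ ρ - q.eval (ρ ^ 2)) • f ρ ∂μ01 := by
      simp only [sub_smul]
      rw [integral_sub, hpoly, sub_zero]
      · exact integrable_continuousOn_smul hf (by fun_prop)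
      · exact integrable_continuousOn_smul hf (by fun_prop)
    rw [hsub, zero_add]
    calc _ ≤ ∫ ρ, ε / (I + 1) * ‖f ρ‖ ∂μ01 := by
          refine norm_integral_le_of_norm_le (hf.norm.const_mul _) ?_
          filter_upwards [ae_restrict_mem measurableSet_Ioo] with ρ hρ
          have hq' := hq (ρ ^ 2) ⟨by positivity, pow_le_one₀ hρ.1.le hρ.2.le⟩
          rw [Real.sqrt_sq hρ.1.le, abs_sub_comm] at hq'
          rw [norm_smul, Real.norm_eq_abs]
          gcongr
      _ = ε / (I + 1) * I := integral_const_mul _ _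
      _ ≤ ε := by
        rw [div_mul_eq_mul_div, div_le_iff₀ (by positivity)]
        nlinarith
  have hloc : LocallyIntegrableOn f (Ioo 0 1) := IntegrableOn.locallyIntegrableOn hf
  have hae := isOpen_Ioo.ae_eq_zero_of_integral_contDiff_smul_eq_zero hloc fun g hg _ hsupp => by
    rw [← hcont g hg.continuous]
    refine (setIntegral_eq_integral_of_forall_compl_eq_zero fun ρ hρ => ?_).symm
    rw [image_eq_zero_of_notMem_tsupport fun hm => hρ (hsupp hm), zero_smul]
  exact (ae_restrict_iff' measurableSet_Ioo).2 hae

/-! ### Eigenvectors of the free wave operator -/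

/-- The odd part of `(1 - ρ)ⁿ`. -/
noncomputable def oddPart (n : ℕ) (ρ : ℝ) : ℝ := ((1 - ρ) ^ n - (1 + ρ) ^ n) / 2

/-- The even part of `(1 - ρ)ⁿ`. -/
noncomputable def evenPart (n : ℕ) (ρ : ℝ) : ℝ := ((1 - ρ) ^ n + (1 + ρ) ^ n) / 2

theorem hasDerivAt_oddPart (n : ℕ) (ρ : ℝ) :
    HasDerivAt (oddPart n) ((-(n * (1 - ρ) ^ (n - 1)) - n * (1 + ρ) ^ (n - 1)) / 2) ρ := by
  have h1 := ((hasDerivAt_id ρ).const_sub 1).pow n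
  have h2 := ((hasDerivAt_id ρ).const_add 1).pow n
  refine ((h1.sub h2).div_const 2).congr_deriv ?_
  simp

theorem hasDerivAt_evenPart (n : ℕ) (ρ : ℝ) :
    HasDerivAt (evenPart n) ((-(n * (1 - ρ) ^ (n - 1)) + n * (1 + ρ) ^ (n - 1)) / 2) ρ := by
  have h1 := ((hasDerivAt_id ρ).const_sub 1).pow n
  have h2 := ((hasDerivAt_id ρ).const_add 1).pow n
  refine ((h1.add h2).div_const 2).congr_deriv ?_
  simp

theorem contDiff_oddPart (n : ℕ) : ContDiff ℝ 1 fun ρ => (oddPart n ρ : ℂ) := by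
  unfold oddPart
  exact Complex.ofRealCLM.contDiff.comp (ContDiff.div_const (by fun_prop) 2)

theorem contDiff_evenPart (n : ℕ) : ContDiff ℝ 1 fun ρ => (evenPart n ρ : ℂ) := by
  unfold evenPart
  exact Complex.ofRealCLM.contDiff.comp (ContDiff.div_const (by fun_prop) 2)

/-- The pair whose components are the odd and the even part of `(1 - ρ)ⁿ`, an eigenvector of the
free wave operator with eigenvalue `-n`. -/
noncomputable def eigenPair (n : ℕ) : C1Dom :=
  ⟨(fun ρ => (oddPart n ρ : ℂ), fun ρ => (evenPart n ρ : ℂ)),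
    (contDiff_oddPart n).contDiffOn, (contDiff_evenPart n).contDiffOn, by simp [oddPart]⟩

theorem derivWithin_ofReal_Icc {g : ℝ → ℝ} {g' ρ : ℝ} (h : HasDerivAt g g' ρ)
    (hρ : ρ ∈ Icc (0 : ℝ) 1) : derivWithin (fun ρ => (g ρ : ℂ)) (Icc 0 1) ρ = g' :=
  h.ofReal_comp.hasDerivWithinAt.derivWithin (uniqueDiffOn_Icc zero_lt_one ρ hρ)

theorem ellH_eigenPair (n : ℕ) : ellH (eigenPair n) = (-n : ℂ) • toH (eigenPair n) := by
  have hpow : ∀ x : ℂ, (n : ℂ) * x ^ n = n * x ^ (n - 1) * x := fun x => by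
    cases n with
    | zero => simp
    | succ m =>
      rw [Nat.add_sub_cancel, pow_succ]
      ring
  rw [← map_smul]
  refine congrArg (WithLp.toLp 2) (Prod.ext ?_ ?_)
  · refine MemLp.toLp_congr (memLp_ell1 _) (memLp_of_continuousOn
      (((-n : ℂ) • eigenPair n).2.1.continuousOn)) ?_
    filter_upwards [ae_restrict_mem measurableSet_Ioo] with ρ hρ
    have hρ' := Ioo_subset_Icc_self hρ
    have h1 := hpow (1 - ρ)
    have h2 := hpow (1 + ρ)
    simp only [ell1, eigenPair, derivWithin_ofReal_Icc (hasDerivAt_oddPart n ρ) hρ',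
      derivWithin_ofReal_Icc (hasDerivAt_evenPart n ρ) hρ', Submodule.coe_smul, Prod.smul_fst,
      Pi.smul_apply, smul_eq_mul]
    rw [oddPart]
    push_cast
    linear_combination (1 / 2 : ℂ) * h1 - (1 / 2 : ℂ) * h2
  · refine MemLp.toLp_congr (memLp_ell2 _) (memLp_of_continuousOn
      (((-n : ℂ) • eigenPair n).2.2.1.continuousOn)) ?_
    filter_upwards [ae_restrict_mem measurableSet_Ioo] with ρ hρ
    have hρ' := Ioo_subset_Icc_self hρ
    have h1 := hpow (1 - ρ)
    have h2 := hpow (1 + ρ)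
    simp only [ell2, eigenPair, derivWithin_ofReal_Icc (hasDerivAt_oddPart n ρ) hρ',
      derivWithin_ofReal_Icc (hasDerivAt_evenPart n ρ) hρ', Submodule.coe_smul, Prod.smul_snd,
      Pi.smul_apply, smul_eq_mul]
    rw [evenPart]
    push_cast
    linear_combination (1 / 2 : ℂ) * h1 + (1 / 2 : ℂ) * h2

theorem inner_toLp {f : ℝ → ℂ} (hf : MemLp f 2 μ01) (g : Lp ℂ 2 μ01) :
    ⟪hf.toLp f, g⟫_ℂ = ∫ ρ, ⟪f ρ, g ρ⟫_ℂ ∂μ01 := by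
  rw [L2.inner_def]
  refine integral_congr_ae ?_
  filter_upwards [hf.coeFn_toLp] with ρ hρ
  rw [hρ]

theorem inner_toH_eigenPair (n : ℕ) (x : H) : ⟪toH (eigenPair n), x⟫_ℂ
    = (∫ ρ, oddPart n ρ • x.fst ρ ∂μ01) + ∫ ρ, evenPart n ρ • x.snd ρ ∂μ01 := by
  have h : ∀ (r : ℝ) (z : ℂ), ⟪(r : ℂ), z⟫_ℂ = r • z := fun r z => by
    simp [mul_comm]
  rw [WithLp.prod_inner_apply]
  refine congrArg₂ (· + ·)
    ((inner_toLp (memLp_of_continuousOn (contDiff_oddPart n).continuous.continuousOn) _).trans ?_)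
    ((inner_toLp (memLp_of_continuousOn (contDiff_evenPart n).continuous.continuousOn) _).trans ?_)
  · exact integral_congr_ae (ae_of_all _ fun ρ => h _ _)
  · exact integral_congr_ae (ae_of_all _ fun ρ => h _ _)

/-- The functional `p ↦ ⟪(odd part of p(1 - ρ), even part of p(1 - ρ)), (f, g)⟫` vanishes on
all real polynomials `p` once it vanishes on the monomials. -/
theorem integral_parity_eq_zero {f g : ℝ → ℂ} (hf : Integrable f μ01) (hg : Integrable g μ01)
    (h : ∀ n, (∫ ρ, oddPart n ρ • f ρ ∂μ01) + ∫ ρ, evenPart n ρ • g ρ ∂μ01 = 0)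
    (p : Polynomial ℝ) :
    (∫ ρ, ((p.eval (1 - ρ) - p.eval (1 + ρ)) / 2) • f ρ ∂μ01)
      + ∫ ρ, ((p.eval (1 - ρ) + p.eval (1 + ρ)) / 2) • g ρ ∂μ01 = 0 := by
  induction p using Polynomial.induction_on' with
  | add p q hp hq =>
    have h1 : ∀ ρ : ℝ, (((p + q).eval (1 - ρ) - (p + q).eval (1 + ρ)) / 2) • f ρ
        = ((p.eval (1 - ρ) - p.eval (1 + ρ)) / 2) • f ρ
          + ((q.eval (1 - ρ) - q.eval (1 + ρ)) / 2) • f ρ := fun ρ => by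
      rw [← add_smul, Polynomial.eval_add, Polynomial.eval_add]
      congr 1
      ring
    have h2 : ∀ ρ : ℝ, (((p + q).eval (1 - ρ) + (p + q).eval (1 + ρ)) / 2) • g ρ
        = ((p.eval (1 - ρ) + p.eval (1 + ρ)) / 2) • g ρ
          + ((q.eval (1 - ρ) + q.eval (1 + ρ)) / 2) • g ρ := fun ρ => by
      rw [← add_smul, Polynomial.eval_add, Polynomial.eval_add]
      congr 1
      ring
    simp only [h1, h2]
    rw [integral_add, integral_add, add_add_add_comm, hp, hq, add_zero]
    · exact integrable_continuousOn_smul hg (by fun_prop)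
    · exact integrable_continuousOn_smul hg (by fun_prop)
    · exact integrable_continuousOn_smul hf (by fun_prop)
    · exact integrable_continuousOn_smul hf (by fun_prop)
  | monomial n a =>
    have h1 : ∀ ρ : ℝ, (((Polynomial.monomial n a).eval (1 - ρ)
        - (Polynomial.monomial n a).eval (1 + ρ)) / 2) • f ρ = a • oddPart n ρ • f ρ := fun ρ => by
      rw [smul_smul, Polynomial.eval_monomial, Polynomial.eval_monomial, oddPart]
      congr 1
      ring
    have h2 : ∀ ρ : ℝ, (((Polynomial.monomial n a).eval (1 - ρ)
        + (Polynomial.monomial n a).eval (1 + ρ)) / 2) • g ρ = a • evenPart n ρ • g ρ := fun ρ => by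
      rw [smul_smul, Polynomial.eval_monomial, Polynomial.eval_monomial, evenPart]
      congr 1
      ring
    simp only [h1, h2]
    rw [integral_smul, integral_smul, ← smul_add, h n, smul_zero]

/-- A vector orthogonal to all eigenvectors is zero. Testing against `(1 - s)^(2k)` and
`(1 - s)^(2k+1)`, `s = 1 - ρ`, isolates the even moments of the second component and the odd
moments of the first. -/
theorem eq_zero_of_inner_eigenPair (x : H) (h : ∀ n, ⟪toH (eigenPair n), x⟫_ℂ = 0) : x = 0 := by
  have hf : Integrable x.fst μ01 := (Lp.memLp x.fst).integrable one_le_two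
  have hg : Integrable x.snd μ01 := (Lp.memLp x.snd).integrable one_le_two
  have hp := integral_parity_eq_zero hf hg fun n => (inner_toH_eigenPair n x).symm.trans (h n)
  have hodd : (fun ρ : ℝ => ρ • x.fst ρ) =ᵐ[μ01] 0 := by
    refine ae_eq_zero_of_even_moments (integrable_continuousOn_smul hf continuousOn_id) fun k => ?_
    refine Eq.trans ?_ (hp ((1 - Polynomial.X) ^ (2 * k + 1)))
    have e : ∀ ρ : ℝ, (1 - (1 + ρ)) ^ (2 * k + 1) = -ρ ^ (2 * k + 1) := fun ρ => by
      rw [show 1 - (1 + ρ) = -ρ by ring, Odd.neg_pow ⟨k, rfl⟩]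
    simp only [Polynomial.eval_pow, Polynomial.eval_sub, Polynomial.eval_one, Polynomial.eval_X,
      e, sub_sub_cancel, sub_neg_eq_add, add_neg_cancel, zero_div, zero_smul, integral_zero,
      add_zero, add_self_div_two, smul_smul, ← pow_succ]
  have heven : x.snd =ᵐ[μ01] 0 := by
    refine ae_eq_zero_of_even_moments hg fun k => ?_
    refine Eq.trans ?_ (hp ((1 - Polynomial.X) ^ (2 * k)))
    have e : ∀ ρ : ℝ, (1 - (1 + ρ)) ^ (2 * k) = ρ ^ (2 * k) := fun ρ => by
      rw [show 1 - (1 + ρ) = -ρ by ring, Even.neg_pow (even_two_mul k)]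
    simp only [Polynomial.eval_pow, Polynomial.eval_sub, Polynomial.eval_one, Polynomial.eval_X,
      e, sub_sub_cancel, sub_self, zero_div, zero_smul, integral_zero, zero_add,
      add_self_div_two]
  have h1 : x.fst = 0 := by
    refine Lp.eq_zero_iff_ae_eq_zero.2 ?_
    filter_upwards [hodd, ae_restrict_mem measurableSet_Ioo] with ρ h0 hρ
    exact (smul_eq_zero.1 h0).resolve_left hρ.1.ne'
  have h2 : x.snd = 0 := Lp.eq_zero_iff_ae_eq_zero.2 heven
  exact WithLp.ofLp_injective 2 (Prod.ext h1 h2)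

theorem denseRange_eigenPair :
    DenseRange (Finsupp.linearCombination ℂ fun n => toH (eigenPair n)) := by
  have h : (LinearMap.range (Finsupp.linearCombination ℂ fun n => toH (eigenPair n)))ᗮ = ⊥ := by
    refine (Submodule.eq_bot_iff _).2 fun x hx => eq_zero_of_inner_eigenPair x fun n => ?_
    refine (Submodule.mem_orthogonal _ _).1 hx _ ⟨Finsupp.single n 1, ?_⟩
    simp
  exact Submodule.dense_iff_topologicalClosure_eq_top.2
    (Submodule.topologicalClosure_eq_top_iff.2 h)

/-! ### The energy identity -/

theorem re_inner_toLp_toLp {f g : ℝ → ℂ} (hf : MemLp f 2 μ01) (hg : MemLp g 2 μ01) :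
    (⟪hf.toLp f, hg.toLp g⟫_ℂ).re
      = ∫ ρ in (0 : ℝ)..1, ((f ρ).re * (g ρ).re + (f ρ).im * (g ρ).im) := by
  rw [intervalIntegral.integral_of_le zero_le_one, integral_Ioc_eq_integral_Ioo]
  have hint : Integrable (fun ρ => ⟪hf.toLp f ρ, hg.toLp g ρ⟫_ℂ) μ01 := L2.integrable_inner _ _
  rw [L2.inner_def]
  refine (integral_re hint).symm.trans (integral_congr_ae ?_)
  filter_upwards [hf.coeFn_toLp, hg.coeFn_toLp] with ρ h1 h2
  rw [h1, h2]
  simp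
  ring

theorem hasDerivAt_re_im {f : ℝ → ℂ} (hf : ContDiffOn ℝ 1 f (Icc 0 1)) {ρ : ℝ}
    (hρ : ρ ∈ Ioo (0 : ℝ) 1) :
    HasDerivAt (fun s => (f s).re) (derivWithin f (Icc 0 1) ρ).re ρ ∧
      HasDerivAt (fun s => (f s).im) (derivWithin f (Icc 0 1) ρ).im ρ := by
  have h : HasDerivAt f (derivWithin f (Icc 0 1) ρ) ρ :=
    ((hf.differentiableOn one_ne_zero ρ (Ioo_subset_Icc_self hρ)).hasDerivWithinAt).hasDerivAt
      (Icc_mem_nhds hρ.1 hρ.2)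
  exact ⟨Complex.reCLM.hasFDerivAt.comp_hasDerivAt ρ h,
    Complex.imCLM.hasFDerivAt.comp_hasDerivAt ρ h⟩

/-- The flux `Re (u₁ ū₂) - ρ (|u₁|² + |u₂|²) / 2`, whose derivative is the density of
`Re ⟪u, L u⟫ - ‖u‖² / 2`. -/
noncomputable def flux (u : (ℝ → ℂ) × (ℝ → ℂ)) (ρ : ℝ) : ℝ :=
  (u.1 ρ).re * (u.2 ρ).re + (u.1 ρ).im * (u.2 ρ).im
    - ρ / 2 * ((u.1 ρ).re ^ 2 + (u.1 ρ).im ^ 2 + ((u.2 ρ).re ^ 2 + (u.2 ρ).im ^ 2))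

/-- The energy identity `Re ⟪u, L u⟫ = ‖u‖² / 2 + flux(1) - flux(0)`. -/
theorem re_inner_ellH (u : C1Dom) :
    (⟪toH u, ellH u⟫_ℂ).re - 1 / 2 * ‖toH u‖ ^ 2 = flux u 1 - flux u 0 := by
  have hf := u.2.1
  have hg := u.2.2.1
  have hcf := hf.continuousOn
  have hcg := hg.continuousOn
  have hdf := continuousOn_derivWithin hf
  have hdg := continuousOn_derivWithin hg
  have hint : ∀ {v w : ℝ → ℂ}, ContinuousOn v (Icc 0 1) → ContinuousOn w (Icc 0 1) →
      IntervalIntegrable (fun ρ => (v ρ).re * (w ρ).re + (v ρ).im * (w ρ).im) volume 0 1 :=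
    fun hv hw => ContinuousOn.intervalIntegrable_of_Icc zero_le_one
      (((Complex.continuous_re.comp_continuousOn hv).mul
        (Complex.continuous_re.comp_continuousOn hw)).add
        ((Complex.continuous_im.comp_continuousOn hv).mul
          (Complex.continuous_im.comp_continuousOn hw)))
  have hl1 : ContinuousOn (ell1 u) (Icc 0 1) :=
    (Complex.continuous_ofReal.neg.continuousOn.mul hdf).add hdg
  have hl2 : ContinuousOn (ell2 u) (Icc 0 1) :=
    hdf.sub (Complex.continuous_ofReal.continuousOn.mul hdg)
  have hm1 := memLp_of_continuousOn hcf
  have hm2 := memLp_of_continuousOn hcg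
  have hL : (⟪toH u, ellH u⟫_ℂ).re
      = (∫ ρ in (0 : ℝ)..1, ((u.1.1 ρ).re * (ell1 u ρ).re + (u.1.1 ρ).im * (ell1 u ρ).im))
        + ∫ ρ in (0 : ℝ)..1, ((u.1.2 ρ).re * (ell2 u ρ).re + (u.1.2 ρ).im * (ell2 u ρ).im) := by
    rw [WithLp.prod_inner_apply, Complex.add_re]
    exact congrArg₂ (· + ·) (re_inner_toLp_toLp hm1 (memLp_ell1 u))
      (re_inner_toLp_toLp hm2 (memLp_ell2 u))
  have hN : ‖toH u‖ ^ 2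
      = (∫ ρ in (0 : ℝ)..1, ((u.1.1 ρ).re * (u.1.1 ρ).re + (u.1.1 ρ).im * (u.1.1 ρ).im))
        + ∫ ρ in (0 : ℝ)..1, ((u.1.2 ρ).re * (u.1.2 ρ).re + (u.1.2 ρ).im * (u.1.2 ρ).im) := by
    refine (inner_self_eq_norm_sq (𝕜 := ℂ) (toH u)).symm.trans ?_
    rw [WithLp.prod_inner_apply]
    refine (Complex.add_re _ _).trans ?_
    exact congrArg₂ (· + ·) (re_inner_toLp_toLp hm1 hm1) (re_inner_toLp_toLp hm2 hm2)
  have hF : ContinuousOn (flux u) (Icc 0 1) := by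
    unfold flux
    fun_prop
  have h1 := (hint hcf hl1).add (hint hcg hl2)
  have h2 := ((hint hcf hcf).add (hint hcg hcg)).const_mul (1 / 2)
  rw [hL, hN, ← intervalIntegral.integral_add (hint hcf hl1) (hint hcg hl2),
    ← intervalIntegral.integral_add (hint hcf hcf) (hint hcg hcg),
    ← intervalIntegral.integral_const_mul, ← intervalIntegral.integral_sub h1 h2]
  refine intervalIntegral.integral_eq_sub_of_hasDerivAt_of_le zero_le_one hF (fun ρ hρ => ?_)
    (h1.sub h2)
  obtain ⟨ha, hb⟩ := hasDerivAt_re_im hf hρ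
  obtain ⟨hc, hd⟩ := hasDerivAt_re_im hg hρ
  have hflux := ((ha.mul hc).add (hb.mul hd)).sub (((hasDerivAt_id ρ).div_const 2).mul
    (((ha.pow 2).add (hb.pow 2)).add ((hc.pow 2).add (hd.pow 2))))
  refine HasDerivAt.congr_deriv hflux ?_
  simp [ell1, ell2]
  ring

theorem quasiDissipative_L0tilde : QuasiDissipative (1 / 2) L0tilde.graph := by
  rw [L0tilde_graph]
  rintro _ ⟨u, rfl⟩
  have h := re_inner_ellH u
  have h0 : flux u 0 = 0 := by simp [flux, u.2.2.2]
  -- at `ρ = 1` the flux is `-|u₁ - u₂|² / 2`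
  have h1 : flux u 1 ≤ 0 := by
    rw [flux]
    nlinarith [sq_nonneg ((u.1.1 1).re - (u.1.2 1).re), sq_nonneg ((u.1.1 1).im - (u.1.2 1).im)]
  change (⟪toH u, ellH u⟫_ℂ).re ≤ 1 / 2 * ‖toH u‖ ^ 2
  linarith

theorem eigenPair_mem_graph (n : ℕ) :
    (toH (eigenPair n), (-n : ℂ) • toH (eigenPair n)) ∈ L0tilde.graph := by
  rw [L0tilde_graph, ← ellH_eigenPair]
  exact ⟨eigenPair n, rfl⟩

end SimWave

theorem mainTheorem4 :
    SimWave.L0tilde.IsClosable ∧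
      ∃ S : SimWave.C0Semigroup SimWave.H,
        S.generator = SimWave.L0tilde.closure ∧
          ∀ τ : ℝ≥0, ‖S.toFun τ‖ ≤ Real.exp ((1 / 2 : ℝ) * (τ : ℝ)) :=
  SimWave.exists_semigroup_generator_eq_closure SimWave.quasiDissipative_L0tilde
    SimWave.eigenPair_mem_graph SimWave.denseRange_eigenPair
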